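/- There is a numerical constant $C>0$ such that the following holds. Let $d,n\ge 1$, let $\Sigma\neq 0$ be a symmetric positive semidefinite $d\times d$ matrix, let $\eta\ge 0$ and $\alpha\in(0,1)$. For $\mu\in\mathbb R^d$ let $\mathbb P_\mu=\mathcal N(\mu,\Sigma)^{\otimes n}$ be the law of an i.i.d. sample of size $n$ from $\mathcal N(\mu,\Sigma)$, and define the minimax separation distance for testing $\|\mu\|\le\eta$ against $\|\mu\|>\eta+\delta$ by $$\delta^*=\inf\Big\{\delta\ge 0:\ \exists\ \text{a test } T:(\mathbb R^d)^n\to\{0,1\}\ \text{with}\ \sup_{\|\mu\|\le\eta}\mathbb P_\mu(T=1)+\sup_{\|\mu\|>\eta+\delta}\mathbb P_\mu(T=0)\le\alpha\Big\}$$ ($\Sigma$ is fixed, and $T$ may depend on it). Put $\sigma_n^2=\|\Sigma\|_{\mathrm{op}}/n$, $d_*=\operatorname{Tr}\Sigma^2/\|\Sigma\|_{\mathrm{op}}^2$ and $u=-\log\alpha+\log 60$. Then, with $\sigma_n/\eta$ read as $+\infty$ if $\eta=0$, $$\delta^*\le C\,\sigma_n\sqrt u\,\max\Big(1,\min\Big(d_*^{1/4},\sqrt{d_*u}\,\frac{\sigma_n}{\eta}\Big)\Big).$$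 If moreover $d_*\ge 3$, then $$\delta^*\ge \sigma_n\sqrt{\frac{1-\alpha}{12}}\,\max\Big(\min\big(1,6\sqrt{1-\alpha}\big),\min\Big(d_*^{1/4},\sqrt{d_*(1-\alpha)}\,\frac{\sigma_n}{\eta}\Big)\Big).$$ In particular, for $\alpha\le 35/36$ the term $\min(1,6\sqrt{1-\alpha})$ equals $1$. -/

import Mathlib

open MeasureTheory ProbabilityTheory
open scoped ENNReal NNReal

/-- The law of an i.i.d. sample `X_1, …, X_n` of Gaussian vectors `N(μ, S)` in `ℝ^d`. -/
noncomputable def gaussianSample {d : ℕ} (n : ℕ) (μ : EuclideanSpace ℝ (Fin d))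
    (S : Matrix (Fin d) (Fin d) ℝ) : Measure (Fin n → EuclideanSpace ℝ (Fin d)) :=
  Measure.pi fun _ => multivariateGaussian μ S

/-- Worst-case type I error of the test `T` (`true` means rejection) for the null hypothesis
`‖μ‖ ≤ η` with Gaussian data of covariance `S`. -/
noncomputable def typeIError {d : ℕ} (n : ℕ) (S : Matrix (Fin d) (Fin d) ℝ) (η : ℝ)
    (T : (Fin n → EuclideanSpace ℝ (Fin d)) → Bool) : ℝ≥0∞ :=
  ⨆ (μ : EuclideanSpace ℝ (Fin d)) (_ : ‖μ‖ ≤ η), gaussianSample n μ S {x | T x = true}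

/-- Worst-case type II error of the test `T` for the alternative `‖μ‖ > η + δ` with Gaussian
data of covariance `S`. -/
noncomputable def typeIIError {d : ℕ} (n : ℕ) (S : Matrix (Fin d) (Fin d) ℝ) (η δ : ℝ)
    (T : (Fin n → EuclideanSpace ℝ (Fin d)) → Bool) : ℝ≥0∞ :=
  ⨆ (μ : EuclideanSpace ℝ (Fin d)) (_ : η + δ < ‖μ‖), gaussianSample n μ S {x | T x = false}

/-- The minimax separation distance `δ*(α, S, η)`: the infimum of the `δ ≥ 0` for which some
(measurable) test has worst-case type I plus worst-case type II error at most `α`. It takes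
values in `[0, ∞]`, so that the infimum of the empty set is `∞`. -/
noncomputable def separationDistance {d : ℕ} (n : ℕ) (S : Matrix (Fin d) (Fin d) ℝ)
    (α η : ℝ) : ℝ≥0∞ :=
  ⨅ (δ : ℝ≥0) (_ : ∃ T : (Fin n → EuclideanSpace ℝ (Fin d)) → Bool, Measurable T ∧
      typeIError n S η T + typeIIError n S η δ T ≤ ENNReal.ofReal α), (δ : ℝ≥0∞)

/-- The operator norm of a matrix acting on Euclidean space. -/
noncomputable def opNorm {d : ℕ} (S : Matrix (Fin d) (Fin d) ℝ) : ℝ :=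
  ‖Matrix.toEuclideanCLM (n := Fin d) (𝕜 := ℝ) S‖

/-- The noise level `σ_n = √(‖S‖_op / n)`. -/
noncomputable def noiseLevel {d : ℕ} (n : ℕ) (S : Matrix (Fin d) (Fin d) ℝ) : ℝ :=
  √(opNorm S / n)

/-- The effective dimension `d_* = Tr S² / ‖S‖_op²`. -/
noncomputable def effectiveDim {d : ℕ} (S : Matrix (Fin d) (Fin d) ℝ) : ℝ :=
  (S ^ 2).trace / opNorm S ^ 2

/-- `min (D^{1/4}, √(D t) · σ / η)`, where `σ / 0` is read as `+∞`. -/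
noncomputable def dimensionFactor (D t σ η : ℝ) : ℝ :=
  if η = 0 then D ^ (1 / 4 : ℝ) else min (D ^ (1 / 4 : ℝ)) (√(D * t) * (σ / η))

/-! In an eigenbasis of `S` a sample is the image of standard normal coordinates under an affine
map, so both bounds reduce to one-dimensional Gaussian integrals, even for singular `S`.

Lower bound: if the chi-square distance from a null law to a mixture of alternatives is at most
`4κ²`, every test has total error at least `1 - κ` (`one_sub_le_measureReal_add_of_chiSq`). The null
mean has length `η` along a top eigenvector. Moving it further along that vector gives the term free
of the dimension. Adding random signs in all other eigendirections gives the other term: the shift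
is orthogonal to the null mean, so reaching norm `η + δ` costs squared length `2ηδ + δ²`, and sign
averaging keeps the chi-square distance small until this is of order `σ_n² √d_*`.

Upper bound: reject when the squared norm of the empirical mean is large. Its exponential moments
(`integral_exp_mul_norm_sq_mean`) control both errors by Chernoff's inequality, and the exponent is
then chosen to balance the resulting terms. -/

/-! ### Spectral decomposition of the covariance -/

open Matrix MatrixOrder in
theorem Matrix.PosSemidef.exists_orthonormalBasis_sqrt {d : ℕ} {S : Matrix (Fin d) (Fin d) ℝ}
    (hS : S.PosSemidef) :
    ∃ (b : OrthonormalBasis (Fin d) ℝ (EuclideanSpace ℝ (Fin d))) (r : Fin d → ℝ),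
      (∀ i, 0 ≤ r i) ∧
      (∀ i, toEuclideanCLM (n := Fin d) (𝕜 := ℝ) (CFC.sqrt S) (b i) = r i • b i) ∧
      (∀ i, toEuclideanCLM (n := Fin d) (𝕜 := ℝ) S (b i) = (r i ^ 2) • b i) := by
  -- Diagonalising the root instead of `S` yields one basis for both; the root is what enters the
  -- definition of the Gaussian law.
  have hR : (CFC.sqrt S).PosSemidef := Matrix.nonneg_iff_posSemidef.mp (CFC.sqrt_nonneg S)
  have h1 : ∀ i, toEuclideanCLM (n := Fin d) (𝕜 := ℝ) (CFC.sqrt S)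
      (hR.isHermitian.eigenvectorBasis i)
        = hR.isHermitian.eigenvalues i • hR.isHermitian.eigenvectorBasis i := by
    intro i
    have := hR.isHermitian.mulVec_eigenvectorBasis i
    ext j
    simpa using congrFun this j
  refine ⟨hR.isHermitian.eigenvectorBasis, hR.isHermitian.eigenvalues,
    hR.eigenvalues_nonneg, h1, fun i => ?_⟩
  have h2 : CFC.sqrt S * CFC.sqrt S = S := CFC.sqrt_mul_sqrt_self _ hS.nonneg
  rw [show toEuclideanCLM (n := Fin d) (𝕜 := ℝ) S = toEuclideanCLM (n := Fin d) (𝕜 := ℝ) (CFC.sqrt S)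
      * toEuclideanCLM (n := Fin d) (𝕜 := ℝ) (CFC.sqrt S) by rw [← map_mul, h2], mul_apply_eq_comp, h1, map_smul, h1, smul_smul, sq]

section Eigen

variable {d : ℕ} {S : Matrix (Fin d) (Fin d) ℝ}
  {b : OrthonormalBasis (Fin d) ℝ (EuclideanSpace ℝ (Fin d))} {l : Fin d → ℝ}

theorem le_opNorm_of_eigen
    (h : ∀ i, Matrix.toEuclideanCLM (n := Fin d) (𝕜 := ℝ) S (b i) = l i • b i) (i : Fin d) :
    l i ≤ opNorm S := by
  have := (Matrix.toEuclideanCLM (n := Fin d) (𝕜 := ℝ) S).le_opNorm (b i)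
  rw [h, norm_smul, b.norm_eq_one, mul_one, mul_one] at this
  exact (le_abs_self _).trans this

theorem exists_eq_opNorm_of_eigen [Nonempty (Fin d)]
    (h : ∀ i, Matrix.toEuclideanCLM (n := Fin d) (𝕜 := ℝ) S (b i) = l i • b i)
    (hl : ∀ i, 0 ≤ l i) : ∃ i, l i = opNorm S := by
  obtain ⟨k, hk⟩ := Finite.exists_max l
  refine ⟨k, (le_opNorm_of_eigen h k).antisymm ?_⟩
  refine ContinuousLinearMap.opNorm_le_bound _ (hl k) fun x => ?_
  have hx : Matrix.toEuclideanCLM (n := Fin d) (𝕜 := ℝ) S x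
      = ∑ i, (l i * inner ℝ (b i) x) • b i := by
    conv_lhs => rw [← b.sum_repr' x]
    simp [map_sum, h, smul_smul, mul_comm]
  refine (sq_le_sq₀ (norm_nonneg _) (mul_nonneg (hl k) (norm_nonneg _))).mp ?_
  rw [hx, mul_pow, ← b.sum_sq_inner_right x, Finset.mul_sum,
    ← b.sum_sq_inner_right (∑ i, _)]
  refine Finset.sum_le_sum fun i _ => ?_
  rw [b.orthonormal.inner_right_fintype, mul_pow]
  gcongr
  · exact hl i
  · exact hk i

theorem trace_sq_eq_sum_of_eigen
    (h : ∀ i, Matrix.toEuclideanCLM (n := Fin d) (𝕜 := ℝ) S (b i) = l i • b i) :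
    (S ^ 2).trace = ∑ i, l i ^ 2 := by
  have h1 : (S ^ 2).trace = LinearMap.trace ℝ _
      (Matrix.toEuclideanCLM (n := Fin d) (𝕜 := ℝ) (S ^ 2)).toLinearMap := by
    rw [← Matrix.trace_toLin_eq _ (EuclideanSpace.basisFun (Fin d) ℝ).toBasis]
    rfl
  rw [h1, LinearMap.trace_eq_sum_inner _ b]
  refine Finset.sum_congr rfl fun i _ => ?_
  simp only [ContinuousLinearMap.coe_coe]
  rw [map_pow, pow_two, mul_apply_eq_comp, h, map_smul, h, smul_smul,
    inner_smul_right, real_inner_self_eq_norm_sq, b.norm_eq_one]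
  ring

theorem opNorm_pos (hS : S ≠ 0) : 0 < opNorm S :=
  norm_pos_iff.mpr fun h => hS <| by simpa using h

end Eigen

/-! ### Gaussian samples in eigencoordinates and their densities -/

-- Writing the law as a push-forward avoids inverting `S`: a shift of the mean within the range of
-- the root becomes a shift `a` of standard coordinates.
open scoped MatrixOrder in
theorem map_pi_gaussianReal_eq_multivariateGaussian {d : ℕ} {S : Matrix (Fin d) (Fin d) ℝ}
    {b : OrthonormalBasis (Fin d) ℝ (EuclideanSpace ℝ (Fin d))} {r : Fin d → ℝ}
    (h : ∀ i, Matrix.toEuclideanCLM (n := Fin d) (𝕜 := ℝ) (CFC.sqrt S) (b i) = r i • b i)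
    (μ : EuclideanSpace ℝ (Fin d)) (a : Fin d → ℝ) :
    (Measure.pi fun i => gaussianReal (a i) 1).map (fun x => μ + ∑ i, (r i * x i) • b i)
      = multivariateGaussian (μ + ∑ i, (r i * a i) • b i) S := by
  have h0 : (Measure.pi fun i => gaussianReal (a i) 1)
      = (Measure.pi fun _ : Fin d => gaussianReal 0 1).map (fun x i => a i + x i) := by
    rw [Measure.pi_map_pi (fun i => by fun_prop)]
    congr 1
    ext1 i
    rw [gaussianReal_map_const_add, zero_add]
  rw [multivariateGaussian, stdGaussian_eq_map_pi_orthonormalBasis b, h0,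
    Measure.map_map (by fun_prop) (by fun_prop), Measure.map_map (by fun_prop) (by fun_prop)]
  congr 1
  ext1 x
  simp only [Function.comp_apply, map_sum, map_smul, h, smul_smul, mul_add, add_smul,
    Finset.sum_add_distrib, mul_comm (x _), add_assoc]

theorem map_mean_gaussianSample {d n : ℕ} (hn : 1 ≤ n) {S : Matrix (Fin d) (Fin d) ℝ}
    (hS : S.PosSemidef) (μ : EuclideanSpace ℝ (Fin d)) :
    (gaussianSample n μ S).map (fun x => (n : ℝ)⁻¹ • ∑ j, x j)
      = multivariateGaussian μ ((n : ℝ)⁻¹ • S) := by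
  have hn' : (n : ℂ) ≠ 0 := by exact_mod_cast (by omega : n ≠ 0)
  have : IsProbabilityMeasure (gaussianSample n μ S) := by
    unfold gaussianSample; infer_instance
  apply Measure.ext_of_charFun
  ext t
  have h1 : (fun x : Fin n → EuclideanSpace ℝ (Fin d) => (n : ℝ)⁻¹ • ∑ j, x j)
      = (fun y => (n : ℝ)⁻¹ • y) ∘ (fun x => ∑ j, x j) := rfl
  rw [h1, ← Measure.map_map (by fun_prop) (by fun_prop), charFun_map_smul, gaussianSample,
    charFun_map_sum_pi_eq_prod, Finset.prod_apply, Finset.prod_const, Finset.card_univ,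
    Fintype.card_fin, charFun_multivariateGaussian hS,
    charFun_multivariateGaussian (hS.smul (by positivity)), ← Complex.exp_nat_mul]
  congr 1
  simp [Matrix.smul_mulVec, Matrix.mulVec_smul, real_inner_smul_left]
  field_simp

/-- On a box the indicator factorises along with the density, and the coordinates are independent,
so the integral splits. -/
theorem MeasureTheory.Measure.pi_withDensity {ι : Type*} [Fintype ι] {X : ι → Type*}
    [∀ i, MeasurableSpace (X i)] (μ : ∀ i, Measure (X i)) [∀ i, IsProbabilityMeasure (μ i)]
    {f : ∀ i, X i → ℝ≥0∞} (hf : ∀ i, Measurable (f i))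
    [∀ i, SigmaFinite ((μ i).withDensity (f i))] :
    Measure.pi (fun i => (μ i).withDensity (f i))
      = (Measure.pi μ).withDensity (fun x => ∏ i, f i (x i)) := by
  refine Measure.pi_eq fun s hs => ?_
  rw [withDensity_apply _ (MeasurableSet.univ_pi hs),
    ← lintegral_indicator (MeasurableSet.univ_pi hs)]
  have h1 : (Set.univ.pi s).indicator (fun x : ∀ i, X i => ∏ i, f i (x i))
      = fun x => ∏ i, (s i).indicator (f i) (x i) := by
    ext x
    by_cases hx : x ∈ Set.univ.pi s
    · rw [Set.indicator_of_mem hx]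
      exact Finset.prod_congr rfl fun i _ => by rw [Set.indicator_of_mem (hx i trivial)]
    · rw [Set.indicator_of_notMem hx]
      simp only [Set.mem_pi, Set.mem_univ, true_imp_iff, not_forall] at hx
      obtain ⟨i, hi⟩ := hx
      exact (Finset.prod_eq_zero (Finset.mem_univ i) (Set.indicator_of_notMem hi _)).symm
  have hm : ∀ i, Measurable ((s i).indicator (f i)) := fun i => (hf i).indicator (hs i)
  rw [h1, lintegral_prod_eq_prod_lintegral_of_indepFun Finset.univ
    (fun i (x : ∀ i, X i) => (s i).indicator (f i) (x i))
    (iIndepFun_pi fun i => (hm i).aemeasurable) (fun i => (hm i).comp (measurable_pi_apply i))]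
  refine Finset.prod_congr rfl fun i _ => ?_
  rw [(measurePreserving_eval μ i).lintegral_comp (hm i), lintegral_indicator (hs i),
    withDensity_apply _ (hs i)]

theorem gaussianReal_one_eq_withDensity (a : ℝ) :
    gaussianReal a 1 = (gaussianReal 0 1).withDensity
      (fun x => ENNReal.ofReal (Real.exp (a * x - a ^ 2 / 2))) := by
  rw [gaussianReal_of_var_ne_zero _ one_ne_zero, gaussianReal_of_var_ne_zero _ one_ne_zero,
    ← withDensity_mul _ (measurable_gaussianPDF _ _) (by fun_prop)]
  congr 1
  ext x
  rw [Pi.mul_apply, gaussianPDF, gaussianPDF, ← ENNReal.ofReal_mul (gaussianPDFReal_nonneg _ _ _),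
    gaussianPDFReal, gaussianPDFReal, mul_assoc (_⁻¹), ← Real.exp_add]
  congr 3
  push_cast
  ring

theorem integrable_exp_mul_sub_gaussianReal (a c : ℝ) :
    Integrable (fun x => Real.exp (a * x - c)) (gaussianReal 0 1) := by
  simp_rw [Real.exp_sub]
  exact (integrable_exp_mul_gaussianReal a).div_const _

theorem integral_exp_mul_sub_gaussianReal (a c : ℝ) :
    ∫ x, Real.exp (a * x - c) ∂(gaussianReal 0 1) = Real.exp (a ^ 2 / 2 - c) := by
  simp_rw [Real.exp_sub]
  rw [integral_div]
  have := congrFun (mgf_id_gaussianReal (μ := 0) (v := 1)) a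
  simp only [mgf, id, NNReal.coe_one] at this
  rw [this]
  simp

section Sample

variable {n d : ℕ}

/-- The density of a sample of unit-covariance Gaussian vectors with mean `a` with respect to
that of a sample of standard Gaussian vectors. -/
noncomputable def shiftDensity (n : ℕ) (a : Fin d → ℝ) (z : Fin n → Fin d → ℝ) : ℝ :=
  ∏ j, ∏ i, Real.exp (a i * z j i - a i ^ 2 / 2)

theorem shiftDensity_nonneg (a : Fin d → ℝ) (z : Fin n → Fin d → ℝ) :
    0 ≤ shiftDensity n a z := by
  unfold shiftDensity; positivity

theorem measurable_shiftDensity (a : Fin d → ℝ) : Measurable (shiftDensity n a) := by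
  unfold shiftDensity; fun_prop

theorem pi_pi_gaussianReal_eq_withDensity (a : Fin d → ℝ) :
    Measure.pi (fun _ : Fin n => Measure.pi fun i => gaussianReal (a i) 1)
      = (Measure.pi fun _ : Fin n => Measure.pi fun _ : Fin d => gaussianReal 0 1).withDensity
          (fun z => ENNReal.ofReal (shiftDensity n a z)) := by
  have : ∀ i, IsProbabilityMeasure ((gaussianReal 0 1).withDensity
      (fun x => ENNReal.ofReal (Real.exp (a i * x - a i ^ 2 / 2)))) := fun i => by
    rw [← gaussianReal_one_eq_withDensity]; infer_instance
  have h1 : (Measure.pi fun i => gaussianReal (a i) 1)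
      = (Measure.pi fun _ : Fin d => gaussianReal 0 1).withDensity
        (fun x => ∏ i, ENNReal.ofReal (Real.exp (a i * x i - a i ^ 2 / 2))) := by
    simp_rw [gaussianReal_one_eq_withDensity (a _)]
    exact Measure.pi_withDensity _ (fun i => by fun_prop)
  have : IsProbabilityMeasure ((Measure.pi fun _ : Fin d => gaussianReal 0 1).withDensity
        (fun x => ∏ i, ENNReal.ofReal (Real.exp (a i * x i - a i ^ 2 / 2)))) := by
    rw [← h1]; infer_instance
  rw [h1, Measure.pi_withDensity _ (fun i => by fun_prop)]
  congr 1
  ext z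
  simp_rw [shiftDensity]
  rw [ENNReal.ofReal_prod_of_nonneg (fun j _ => by positivity)]
  refine Finset.prod_congr rfl fun j _ => ?_
  rw [ENNReal.ofReal_prod_of_nonneg (fun j _ => by positivity)]

theorem shiftDensity_mul (a a' : Fin d → ℝ) (z : Fin n → Fin d → ℝ) :
    shiftDensity n a z * shiftDensity n a' z
      = ∏ j, ∏ i, Real.exp ((a i + a' i) * z j i - (a i ^ 2 + a' i ^ 2) / 2) := by
  simp_rw [shiftDensity, ← Finset.prod_mul_distrib, ← Real.exp_add]
  refine Finset.prod_congr rfl fun j _ => Finset.prod_congr rfl fun i _ => ?_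
  ring_nf

theorem integrable_shiftDensity_mul (a a' : Fin d → ℝ) :
    Integrable (fun z => shiftDensity n a z * shiftDensity n a' z)
      (Measure.pi fun _ : Fin n => Measure.pi fun _ : Fin d => gaussianReal 0 1) := by
  simp_rw [shiftDensity_mul]
  refine Integrable.fintype_prod
    (f := fun _ (y : Fin d → ℝ) => ∏ i, Real.exp ((a i + a' i) * y i - (a i ^ 2 + a' i ^ 2) / 2))
    fun j => ?_
  exact Integrable.fintype_prod
    (f := fun i (y : ℝ) => Real.exp ((a i + a' i) * y - (a i ^ 2 + a' i ^ 2) / 2))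
    fun i => integrable_exp_mul_sub_gaussianReal _ _

/-- In each coordinate the Gaussian moment contributes `(a i + a' i)² / 2`, and the normalisations
remove the squares, leaving the cross term. These are the entries of the chi-square computation. -/
theorem integral_shiftDensity_mul (a a' : Fin d → ℝ) :
    ∫ z, shiftDensity n a z * shiftDensity n a' z
      ∂(Measure.pi fun _ : Fin n => Measure.pi fun _ : Fin d => gaussianReal 0 1)
      = Real.exp (n * ∑ i, a i * a' i) := by
  simp_rw [shiftDensity_mul]
  rw [integral_fintype_prod_eq_prod (fun _ (y : Fin d → ℝ) =>
    ∏ i, Real.exp ((a i + a' i) * y i - (a i ^ 2 + a' i ^ 2) / 2))]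
  simp_rw [integral_fintype_prod_eq_prod (fun i (y : ℝ) =>
    Real.exp ((a i + a' i) * y - (a i ^ 2 + a' i ^ 2) / 2)), integral_exp_mul_sub_gaussianReal]
  rw [Finset.prod_const, Finset.card_univ, Fintype.card_fin, ← Real.exp_sum, ← Real.exp_nat_mul]
  congr 3
  ext i
  ring

end Sample

/-! ### Testing lower bounds from the chi-square distance -/

/-- Le Cam's two-point method with a mixture of alternatives, in chi-square form. -/
theorem one_sub_le_measureReal_add_of_chiSq {Ω ι : Type*} [MeasurableSpace Ω] [Fintype ι]
    [Nonempty ι] (Q : Measure Ω) [IsProbabilityMeasure Q] (P : ι → Measure Ω)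
    [∀ k, IsProbabilityMeasure (P k)] (L : ι → Ω → ℝ) (hL0 : ∀ k x, 0 ≤ L k x)
    (hLm : ∀ k, Measurable (L k)) (hP : ∀ k, P k = Q.withDensity (fun x => ENNReal.ofReal (L k x)))
    (hint : ∀ k l, Integrable (fun x => L k x * L l x) Q) {κ : ℝ} (hκ : 0 < κ)
    (hG : ∑ k, ∑ l, ∫ x, L k x * L l x ∂Q ≤ (Fintype.card ι : ℝ) ^ 2 * (1 + 4 * κ ^ 2))
    {A : Set Ω} (hA : MeasurableSet A) {β : ℝ} (hβ : ∀ k, (P k).real Aᶜ ≤ β) :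
    1 - κ ≤ Q.real A + β := by
  have hN : (0 : ℝ) < Fintype.card ι := by exact_mod_cast Fintype.card_pos
  set N : ℝ := (Fintype.card ι : ℝ)
  have hPr : ∀ k s, MeasurableSet s → Integrable (L k) Q ∧ (P k).real s = ∫ x in s, L k x ∂Q := by
    intro k s hs
    have hfin : ∫⁻ x, ENNReal.ofReal (L k x) ∂Q = 1 := by
      have := measure_univ (μ := P k)
      rwa [hP k, withDensity_apply _ MeasurableSet.univ, Measure.restrict_univ] at this
    have hi : Integrable (L k) Q := by
      refine ⟨(hLm k).aestronglyMeasurable, ?_⟩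
      rw [hasFiniteIntegral_iff_ofReal (Filter.Eventually.of_forall (hL0 k)), hfin]
      simp
    refine ⟨hi, ?_⟩
    rw [measureReal_def, hP k, withDensity_apply _ hs,
      integral_eq_lintegral_of_nonneg_ae (Filter.Eventually.of_forall (hL0 k))
        (hLm k).aestronglyMeasurable]
  have hLi : ∀ k, Integrable (L k) Q := fun k => (hPr k _ MeasurableSet.univ).1
  have hL1 : ∀ k, ∫ x, L k x ∂Q = 1 := by
    intro k
    have := (hPr k _ MeasurableSet.univ).2
    rw [probReal_univ, setIntegral_univ] at this
    exact this.symm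
  -- `M` is the density of the uniform mixture; `hG` says that its second moment is at most `1 +
  -- 4κ²`.
  let M : Ω → ℝ := fun x => N⁻¹ * ∑ k, L k x
  have hMi : Integrable M Q := (integrable_finsetSum _ fun k _ => hLi k).const_mul _
  have hM1 : ∫ x, M x ∂Q = 1 := by
    simp only [M]
    rw [integral_const_mul, integral_finsetSum _ fun k _ => hLi k]
    simp only [hL1, Finset.sum_const, Finset.card_univ, nsmul_eq_mul, mul_one]
    exact inv_mul_cancel₀ hN.ne'
  have hM2e : ∀ x, M x ^ 2 = (N ^ 2)⁻¹ * ∑ k, ∑ l, L k x * L l x := by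
    intro x
    simp only [M]
    rw [mul_pow, pow_two (∑ k, L k x), Finset.sum_mul_sum, inv_pow]
  have hM2i : Integrable (fun x => M x ^ 2) Q := by
    simp_rw [hM2e]
    exact (integrable_finsetSum _ fun k _ => integrable_finsetSum _ fun l _ => hint k l).const_mul _
  have hM2 : ∫ x, M x ^ 2 ∂Q ≤ 1 + 4 * κ ^ 2 := by
    simp_rw [hM2e]
    rw [integral_const_mul, integral_finsetSum _ fun k _ =>
      integrable_finsetSum _ fun l _ => hint k l]
    simp_rw [integral_finsetSum _ fun l _ => hint _ l]
    rw [inv_mul_le_iff₀ (by positivity)]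
    exact hG
  have hAc : ∫ x in Aᶜ, M x ∂Q ≤ β := by
    simp only [M]
    rw [integral_const_mul, integral_finsetSum _ fun k _ => (hLi k).integrableOn,
      inv_mul_le_iff₀ hN]
    calc ∑ k, ∫ x in Aᶜ, L k x ∂Q ≤ ∑ _k : ι, β :=
          Finset.sum_le_sum fun k _ => by rw [← (hPr k _ hA.compl).2]; exact hβ k
      _ = N * β := by simp [N]
  have hQA : Q.real A = ∫ x, A.indicator 1 x ∂Q := (integral_indicator_one hA).symm
  have hsplit : ∫ x in Aᶜ, M x ∂Q = ∫ x, Aᶜ.indicator M x ∂Q :=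
    (integral_indicator hA.compl).symm
  have hi1 : Integrable (A.indicator (1 : Ω → ℝ)) Q := (integrable_const 1).indicator hA
  have hi2 : Integrable (Aᶜ.indicator M) Q := hMi.indicator hA.compl
  have hκ' : 0 < 8 * κ := by positivity
  -- Pointwise form of Young's inequality for `(1_A - 1/2) (M - 1)`.
  have hpt : ∀ x, 1 + (M x - 1) / 2 - (κ / 2 + ((M x ^ 2 - 1) - 2 * (M x - 1)) / (8 * κ))
      ≤ A.indicator 1 x + Aᶜ.indicator M x := by
    intro x
    -- The pointwise error is at least `min 1 M = 1 + (M - 1)/2 - |M - 1|/2`. Young's inequality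
    -- with this weight replaces Cauchy-Schwarz: integrated, its right side is at most `κ/2 +
    -- 4κ²/(8κ) = κ`.
    have key : ∀ y : ℝ, |y| / 2 ≤ κ / 2 + y ^ 2 / (8 * κ) := by
      intro y
      have : κ / 2 + y ^ 2 / (8 * κ) - |y| / 2 = (|y| - 2 * κ) ^ 2 / (8 * κ) := by
        rw [← sq_abs y]
        field_simp
        ring
      have h2 : 0 ≤ (|y| - 2 * κ) ^ 2 / (8 * κ) := by positivity
      linarith
    have hk := key (M x - 1)
    rw [show (M x - 1) ^ 2 = (M x ^ 2 - 1) - 2 * (M x - 1) by ring] at hk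
    by_cases hx : x ∈ A
    · rw [Set.indicator_of_mem hx, Set.indicator_of_notMem (by simpa using hx)]
      simp only [Pi.one_apply]
      linarith [le_abs_self (M x - 1)]
    · rw [Set.indicator_of_notMem hx, Set.indicator_of_mem (by simpa using hx)]
      linarith [neg_abs_le (M x - 1)]
  have hMi' : Integrable (fun x => M x - 1) Q := hMi.sub (integrable_const 1)
  have hM2i' : Integrable (fun x => M x ^ 2 - 1) Q := hM2i.sub (integrable_const 1)
  have hlin : Integrable (fun x => (M x ^ 2 - 1) - 2 * (M x - 1)) Q :=
    hM2i'.sub (hMi'.const_mul 2)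
  have e1 : ∫ x, (M x - 1) ∂Q = 0 := by
    rw [integral_sub hMi (integrable_const 1), hM1]; simp
  have e2 : ∫ x, (M x ^ 2 - 1) ∂Q = ∫ x, M x ^ 2 ∂Q - 1 := by
    rw [integral_sub hM2i (integrable_const 1)]; simp
  have e3 : ∫ x, ((M x ^ 2 - 1) - 2 * (M x - 1)) ∂Q = ∫ x, M x ^ 2 ∂Q - 1 := by
    rw [integral_sub hM2i' (hMi'.const_mul 2), integral_const_mul, e1, e2]; ring
  have hli2 : Integrable (fun x => 1 + (M x - 1) / 2) Q :=
    (integrable_const 1).add (hMi'.div_const 2)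
  have hli3 : Integrable (fun x => κ / 2 + ((M x ^ 2 - 1) - 2 * (M x - 1)) / (8 * κ)) Q :=
    (integrable_const _).add (hlin.div_const _)
  have hmono : ∫ x, (1 + (M x - 1) / 2 - (κ / 2 + ((M x ^ 2 - 1) - 2 * (M x - 1)) / (8 * κ))) ∂Q
      ≤ ∫ x, (A.indicator 1 x + Aᶜ.indicator M x) ∂Q :=
    integral_mono (hli2.sub hli3) (hi1.add hi2) hpt
  rw [integral_sub hli2 hli3, integral_add (integrable_const _) (hlin.div_const _),
    integral_add (integrable_const _) (hMi'.div_const 2),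
    integral_add hi1 hi2, integral_div (8 * κ), integral_div 2 (fun x => M x - 1), e1, e3, ← hQA, ← hsplit] at hmono
  simp only [integral_const, probReal_univ, smul_eq_mul, one_mul, zero_div, add_zero] at hmono
  have h3 : (∫ x, M x ^ 2 ∂Q - 1) / (8 * κ) ≤ κ / 2 := by
    rw [div_le_iff₀ hκ']
    nlinarith
  linarith

theorem OrthonormalBasis.norm_sq_sum_smul {ι E : Type*} [Fintype ι] [NormedAddCommGroup E]
    [InnerProductSpace ℝ E] (b : OrthonormalBasis ι ℝ E) (c : ι → ℝ) :
    ‖∑ i, c i • b i‖ ^ 2 = ∑ i, c i ^ 2 := by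
  rw [← b.sum_sq_inner_right]
  simp_rw [b.orthonormal.inner_right_fintype]

open scoped MatrixOrder in
theorem map_pi_pi_gaussianReal_eq_gaussianSample {d n : ℕ} {S : Matrix (Fin d) (Fin d) ℝ}
    {b : OrthonormalBasis (Fin d) ℝ (EuclideanSpace ℝ (Fin d))} {r : Fin d → ℝ}
    (h : ∀ i, Matrix.toEuclideanCLM (n := Fin d) (𝕜 := ℝ) (CFC.sqrt S) (b i) = r i • b i)
    (μ : EuclideanSpace ℝ (Fin d)) (a : Fin d → ℝ) :
    (Measure.pi fun _ : Fin n => Measure.pi fun i => gaussianReal (a i) 1).map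
        (fun z j => μ + ∑ i, (r i * z j i) • b i)
      = gaussianSample n (μ + ∑ i, (r i * a i) • b i) S := by
  rw [gaussianSample, ← map_pi_gaussianReal_eq_multivariateGaussian h]
  exact Measure.pi_map_pi (f := fun _ (x : Fin d → ℝ) => μ + ∑ i, (r i * x i) • b i)
    fun _ => Measurable.aemeasurable (by fun_prop)

open scoped MatrixOrder in
/-- Lower bound for the testing error by a mixture of alternatives, in the coordinates of an
eigenbasis of the covariance. -/
theorem one_sub_le_of_alternatives {d n : ℕ} {S : Matrix (Fin d) (Fin d) ℝ}
    {b : OrthonormalBasis (Fin d) ℝ (EuclideanSpace ℝ (Fin d))} {r : Fin d → ℝ}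
    (h : ∀ i, Matrix.toEuclideanCLM (n := Fin d) (𝕜 := ℝ) (CFC.sqrt S) (b i) = r i • b i)
    {ι : Type*} [Fintype ι] [Nonempty ι] {α η δ κ : ℝ} (hα : 0 ≤ α) (hη : 0 ≤ η) (hδ : 0 ≤ δ)
    (hκ : 0 < κ) {T : (Fin n → EuclideanSpace ℝ (Fin d)) → Bool} (hT : Measurable T)
    (herr : typeIError n S η T + typeIIError n S η δ T ≤ ENNReal.ofReal α)
    (m : Fin d → ℝ) (hm : ∑ i, m i ^ 2 ≤ η ^ 2) (a : ι → Fin d → ℝ)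
    (ha : ∀ k, (η + δ) ^ 2 < ∑ i, (m i + r i * a k i) ^ 2)
    (hG : ∑ k, ∑ l, Real.exp (n * ∑ i, a k i * a l i)
      ≤ (Fintype.card ι : ℝ) ^ 2 * (1 + 4 * κ ^ 2)) :
    1 - κ ≤ α := by
  set μ₀ : EuclideanSpace ℝ (Fin d) := ∑ i, m i • b i with hμ₀
  -- The test is pulled back along `Φ` to the standard coordinates, where null and alternatives have
  -- explicit mutual densities; the null is the shift `0`.
  set Φ : (Fin n → Fin d → ℝ) → (Fin n → EuclideanSpace ℝ (Fin d)) :=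
    fun z j => μ₀ + ∑ i, (r i * z j i) • b i with hΦ
  have hΦm : Measurable Φ := by fun_prop
  set A : Set (Fin n → Fin d → ℝ) := Φ ⁻¹' {x | T x = true} with hAdef
  have hTm : MeasurableSet {x | T x = true} := hT (measurableSet_singleton true)
  have hTf : MeasurableSet {x | T x = false} := hT (measurableSet_singleton false)
  have hA : MeasurableSet A := hΦm hTm
  have hlaw := fun a => map_pi_pi_gaussianReal_eq_gaussianSample (n := n) h μ₀ a
  have htop : typeIError n S η T + typeIIError n S η δ T ≠ ∞ :=
    ne_top_of_le_ne_top ENNReal.ofReal_ne_top herr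
  have hI : (Measure.pi fun _ : Fin n => Measure.pi fun _ : Fin d => gaussianReal 0 1).real A
      ≤ (typeIError n S η T).toReal := by
    refine ENNReal.toReal_mono (ENNReal.add_ne_top.mp htop).1 ?_
    rw [hAdef, ← Measure.map_apply hΦm hTm, hlaw (fun _ => 0)]
    simp only [mul_zero, zero_smul, Finset.sum_const_zero, add_zero]
    refine le_iSup₂_of_le μ₀ ?_ le_rfl
    refine (sq_le_sq₀ (norm_nonneg _) hη).mp ?_
    rwa [hμ₀, b.norm_sq_sum_smul]
  have hII : ∀ k, (Measure.pi fun _ : Fin n => Measure.pi fun i => gaussianReal (a k i) 1).real Aᶜ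
      ≤ (typeIIError n S η δ T).toReal := by
    intro k
    refine ENNReal.toReal_mono (ENNReal.add_ne_top.mp htop).2 ?_
    have hAc : Aᶜ = Φ ⁻¹' {x | T x = false} := by
      ext z; simp [hAdef]
    rw [hAc, ← Measure.map_apply hΦm hTf, hlaw (a k)]
    refine le_iSup₂_of_le (μ₀ + ∑ i, (r i * a k i) • b i) ?_ le_rfl
    refine (sq_lt_sq₀ (by positivity) (norm_nonneg _)).mp ?_
    rw [hμ₀, ← Finset.sum_add_distrib]
    simp_rw [← add_smul]
    rw [b.norm_sq_sum_smul]
    exact ha k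
  have := one_sub_le_measureReal_add_of_chiSq
    (Measure.pi fun _ : Fin n => Measure.pi fun _ : Fin d => gaussianReal 0 1)
    (fun k => Measure.pi fun _ : Fin n => Measure.pi fun i => gaussianReal (a k i) 1)
    (fun k => shiftDensity n (a k)) (fun k => shiftDensity_nonneg (a k))
    (fun k => measurable_shiftDensity (a k)) (fun k => pi_pi_gaussianReal_eq_withDensity (a k))
    (fun k l => integrable_shiftDensity_mul (a k) (a l)) hκ
    (by simpa only [integral_shiftDensity_mul] using hG) hA hII
  have h2 := ENNReal.toReal_mono ENNReal.ofReal_ne_top herr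
  rw [ENNReal.toReal_add (ENNReal.add_ne_top.mp htop).1 (ENNReal.add_ne_top.mp htop).2,
    ENNReal.toReal_ofReal hα] at h2
  linarith

/-! ### The two lower bounds -/

/-- For fixed `k`, summing over `l` factorises into hyperbolic cosines, independent of `k` by
evenness; then `cosh y ≤ exp (y² / 2)`. The first-order term cancels, so the exponent is quadratic
in `t`. -/
theorem sum_sum_exp_sign_mul_le {d : ℕ} (w : Fin d → ℝ) (t : ℝ) :
    ∑ k : Fin d → Bool, ∑ l : Fin d → Bool,
        Real.exp (t * ∑ i, ((bif k i then 1 else -1) * w i) * ((bif l i then 1 else -1) * w i))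
      ≤ (Fintype.card (Fin d → Bool) : ℝ) ^ 2 * Real.exp (t ^ 2 * (∑ i, w i ^ 4) / 2) := by
  have h1 : ∀ k l : Fin d → Bool,
      Real.exp (t * ∑ i, ((bif k i then 1 else -1) * w i) * ((bif l i then 1 else -1) * w i))
        = ∏ i, Real.exp (t * (((bif k i then 1 else -1) * w i) *
            ((bif l i then 1 else -1) * w i))) := by
    intro k l
    rw [Finset.mul_sum, Real.exp_sum]
  have h2 : ∀ k : Fin d → Bool, ∑ l : Fin d → Bool, ∏ i,
      Real.exp (t * (((bif k i then 1 else -1) * w i) * ((bif l i then 1 else -1) * w i)))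
        = ∏ i, (2 * Real.cosh (t * w i ^ 2)) := by
    intro k
    rw [← Fintype.prod_sum fun i (y : Bool) =>
      Real.exp (t * (((bif k i then 1 else -1) * w i) * ((bif y then 1 else -1) * w i)))]
    refine Finset.prod_congr rfl fun i _ => ?_
    rw [Real.cosh_eq]
    cases k i <;> simp only [Fintype.sum_bool, cond_true, cond_false] <;> ring_nf
  simp_rw [h1, h2]
  rw [Finset.sum_const, Finset.card_univ, nsmul_eq_mul, pow_two, mul_assoc]
  refine mul_le_mul_of_nonneg_left ?_ (by positivity)
  rw [Finset.prod_mul_distrib, Finset.prod_const, Finset.card_univ, Fintype.card_fun,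
    Fintype.card_bool]
  push_cast
  refine mul_le_mul_of_nonneg_left ?_ (by positivity)
  rw [Finset.mul_sum, Finset.sum_div, Real.exp_sum]
  refine Finset.prod_le_prod (fun i _ => (Real.cosh_pos _).le) fun i _ => ?_
  refine (Real.cosh_le_exp_half_sq _).trans_eq ?_
  ring_nf

theorem Real.exp_le_one_add_add_sq {x : ℝ} (h0 : 0 ≤ x) (h1 : x ≤ 1) :
    Real.exp x ≤ 1 + x + x ^ 2 := by
  have := (abs_le.mp (Real.abs_exp_sub_one_sub_id_le (by rwa [abs_of_nonneg h0]))).2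
  linarith

section LowerBound

variable {d n : ℕ} {S : Matrix (Fin d) (Fin d) ℝ}

theorem opNorm_nonneg (S : Matrix (Fin d) (Fin d) ℝ) : 0 ≤ opNorm S := norm_nonneg _

theorem noiseLevel_sq (n : ℕ) (S : Matrix (Fin d) (Fin d) ℝ) :
    noiseLevel n S ^ 2 = opNorm S / n :=
  Real.sq_sqrt (div_nonneg (opNorm_nonneg S) n.cast_nonneg)

theorem noiseLevel_pos (hn : 1 ≤ n) (hS : S ≠ 0) : 0 < noiseLevel n S :=
  Real.sqrt_pos.mpr (div_pos (opNorm_pos hS) (by exact_mod_cast hn))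

theorem nonempty_of_matrix_ne_zero (hS : S ≠ 0) : Nonempty (Fin d) := by
  by_contra h
  rw [not_nonempty_iff] at h
  exact hS (Subsingleton.elim _ _)

theorem le_of_two_point (hn : 1 ≤ n) (hS : S.PosSemidef) (hS0 : S ≠ 0) {α η δ : ℝ}
    (hα : 0 < α) (hα1 : α < 1) (hη : 0 ≤ η) (hδ : 0 ≤ δ)
    {T : (Fin n → EuclideanSpace ℝ (Fin d)) → Bool} (hT : Measurable T)
    (herr : typeIError n S η T + typeIIError n S η δ T ≤ ENNReal.ofReal α) :
    noiseLevel n S * √((1 - α) / 12) * min 1 (6 * √(1 - α)) ≤ δ := by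
  by_contra! hlt
  -- The alternative is the strict inequality `η + δ < ‖μ‖`, so the mean is placed at radius `η +
  -- δ'` with `δ' > δ`.
  obtain ⟨δ', hδ', hlt'⟩ := exists_between hlt
  have := nonempty_of_matrix_ne_zero hS0
  obtain ⟨b, r, hr0, hr, hrS⟩ := hS.exists_orthonormalBasis_sqrt
  obtain ⟨i₀, hi₀⟩ := exists_eq_opNorm_of_eigen hrS (fun i => sq_nonneg _)
  have hri : 0 < r i₀ := by
    refine (hr0 i₀).lt_of_ne fun h => ?_
    rw [← h] at hi₀
    have := opNorm_pos hS0
    simp at hi₀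
    linarith
  have hσ := noiseLevel_pos hn hS0
  have hσ2 := noiseLevel_sq n S
  have hn0 : (0 : ℝ) < n := by exact_mod_cast hn
  set σ := noiseLevel n S
  have hβ : 0 < 1 - α := by linarith
  have hδ0 : 0 ≤ δ' := hδ.trans hδ'.le
  have hs1 : √((1 - α) / 12) ^ 2 = (1 - α) / 12 := Real.sq_sqrt (by positivity)
  have hs2 : √(1 - α) ^ 2 = 1 - α := Real.sq_sqrt hβ.le
  have hx1 : δ' ^ 2 ≤ σ ^ 2 * ((1 - α) / 12) := by
    rw [← hs1, ← mul_pow]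
    refine pow_le_pow_left₀ hδ0 (hlt'.le.trans ?_) 2
    exact mul_le_of_le_one_right (by positivity) (min_le_left _ _)
  have hx2 : δ' ^ 2 ≤ σ ^ 2 * (3 * (1 - α) ^ 2) := by
    have : σ ^ 2 * (3 * (1 - α) ^ 2) = (σ * √((1 - α) / 12) * (6 * √(1 - α))) ^ 2 := by
      rw [mul_pow, mul_pow, mul_pow, hs1, hs2]; ring
    rw [this]
    refine pow_le_pow_left₀ hδ0 (hlt'.le.trans ?_) 2
    gcongr
    exact min_le_right _ _
  -- Any `κ < 1 - α` gives a contradiction. Here `exp x ≤ 1 + (13/12) x ≤ 1 + (13/4) (1 - α)²`, and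
  -- `13/4 ≤ 4 · 0.95²`.
  have key := one_sub_le_of_alternatives hr (ι := Unit) (κ := 95 / 100 * (1 - α)) hα.le hη hδ
    (by positivity) hT herr (Pi.single i₀ η) ?_ (fun _ => Pi.single i₀ (δ' / r i₀)) ?_ ?_
  · linarith
  · rw [Finset.sum_eq_single i₀] <;> simp +contextual
  · intro _
    rw [Finset.sum_eq_single i₀ (by simp +contextual) (by simp)]
    simp only [Pi.single_eq_same]
    rw [mul_div_cancel₀ _ hri.ne']
    gcongr
  · simp only [Finset.univ_unique, Finset.sum_singleton, Fintype.card_unique, Nat.cast_one,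
      one_pow, one_mul]
    rw [Finset.sum_eq_single i₀ (by simp +contextual) (by simp)]
    simp only [Pi.single_eq_same]
    have hx : (n : ℝ) * (δ' / r i₀ * (δ' / r i₀)) = δ' ^ 2 / σ ^ 2 := by
      rw [hσ2, ← hi₀]
      field_simp
    rw [hx]
    set x := δ' ^ 2 / σ ^ 2 with hxdef
    have h0 : 0 ≤ x := by positivity
    have h1 : x ≤ (1 - α) / 12 := by rw [hxdef, div_le_iff₀ (by positivity)]; linarith
    have h2 : x ≤ 3 * (1 - α) ^ 2 := by rw [hxdef, div_le_iff₀ (by positivity)]; linarith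
    refine (Real.exp_le_one_add_add_sq h0 (by linarith)).trans ?_
    have h3 : x ^ 2 ≤ x * (1 / 12) := by rw [sq]; gcongr; linarith
    nlinarith

/-- One entry of the minimum controls `δ²`, the other `ηδ`. The constant is `2 · 7/24 + 1/12 = 2/3`,
where `7/24` is a rational upper bound for `1/√12`. -/
theorem two_mul_add_sq_le_of_le_dimensionFactor {σ D β η δ : ℝ} (hσ : 0 < σ) (hD0 : 0 < D)
    (hβ : 0 < β) (hη : 0 ≤ η) (hδ : 0 ≤ δ) (hlt : δ ≤ σ * √(β / 12) * dimensionFactor D β σ η) :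
    2 * η * δ + δ ^ 2 ≤ σ ^ 2 * (2 / 3 * β) * √D := by
  have hs1 : √(β / 12) ^ 2 = β / 12 := Real.sq_sqrt (by positivity)
  have hD4 : (D ^ (1 / 4 : ℝ)) ^ 2 = √D := by
    rw [← Real.rpow_natCast, ← Real.rpow_mul hD0.le, Real.sqrt_eq_rpow]
    norm_num
  have hle1 : dimensionFactor D β σ η ≤ D ^ (1 / 4 : ℝ) := by
    unfold dimensionFactor
    split_ifs
    · exact le_rfl
    · exact min_le_left _ _
  have hle2 : η * dimensionFactor D β σ η ≤ √(D * β) * σ := by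
    unfold dimensionFactor
    split_ifs with h0
    · rw [h0, zero_mul]; positivity
    · refine (mul_le_mul_of_nonneg_left (min_le_right _ _) hη).trans_eq ?_
      field_simp
  have hsq : δ ^ 2 ≤ σ ^ 2 * (β / 12) * √D := by
    rw [← hD4, ← hs1, ← mul_pow, ← mul_pow]
    exact pow_le_pow_left₀ hδ (hlt.trans (by gcongr)) 2
  have hlin : η * δ ≤ σ ^ 2 * (7 / 24 * β) * √D := by
    have h12 : √(β / 12) ≤ 7 / 24 * √β := by
      rw [Real.sqrt_le_left (by positivity), mul_pow, Real.sq_sqrt hβ.le]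
      linarith
    calc η * δ ≤ η * (σ * √(β / 12) * dimensionFactor D β σ η) := by gcongr
      _ = σ * √(β / 12) * (η * dimensionFactor D β σ η) := by ring
      _ ≤ σ * √(β / 12) * (√(D * β) * σ) := by gcongr
      _ ≤ σ * (7 / 24 * √β) * (√(D * β) * σ) := by gcongr
      _ = σ ^ 2 * (7 / 24 * √β ^ 2) * √D := by rw [Real.sqrt_mul hD0.le]; ring
      _ = σ ^ 2 * (7 / 24 * β) * √D := by rw [Real.sq_sqrt hβ.le]
  linarith

theorem Real.exp_le_one_add_four_mul_div_three_sq {x β : ℝ} (hx0 : 0 ≤ x) (hβ : 0 ≤ β)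
    (hβ1 : β ≤ 1) (hx : x ≤ β ^ 2 / 3) : Real.exp x ≤ 1 + 4 * (β / 3) ^ 2 := by
  have h1 : β ^ 2 ≤ 1 := pow_le_one₀ hβ hβ1
  refine (Real.exp_le_one_add_add_sq hx0 (by linarith)).trans ?_
  have h3 : x ^ 2 ≤ x * (1 / 3) := by rw [sq]; gcongr; linarith
  linarith

theorem le_of_rademacher_mixture (hn : 1 ≤ n) (hS : S.PosSemidef) (hS0 : S ≠ 0) {α η δ : ℝ}
    (hα : 0 < α) (hα1 : α < 1) (hη : 0 ≤ η) (hδ : 0 ≤ δ) (hD : 3 ≤ effectiveDim S)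
    {T : (Fin n → EuclideanSpace ℝ (Fin d)) → Bool} (hT : Measurable T)
    (herr : typeIError n S η T + typeIIError n S η δ T ≤ ENNReal.ofReal α) :
    noiseLevel n S * √((1 - α) / 12) *
      dimensionFactor (effectiveDim S) (1 - α) (noiseLevel n S) η ≤ δ := by
  by_contra! hlt
  obtain ⟨δ', hδ', hlt'⟩ := exists_between hlt
  have := nonempty_of_matrix_ne_zero hS0
  obtain ⟨b, r, hr0, hr, hrS⟩ := hS.exists_orthonormalBasis_sqrt
  obtain ⟨i₀, hi₀⟩ := exists_eq_opNorm_of_eigen hrS (fun i => sq_nonneg _)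
  have htr := trace_sq_eq_sum_of_eigen hrS
  have hop := opNorm_pos hS0
  have hDdef : (S ^ 2).trace = effectiveDim S * opNorm S ^ 2 := by
    rw [effectiveDim]; field_simp
  have hσ := noiseLevel_pos hn hS0
  have hσ2 := noiseLevel_sq n S
  have hn0 : (0 : ℝ) < n := by exact_mod_cast hn
  set σ := noiseLevel n S
  set D := effectiveDim S
  have hβ : 0 < 1 - α := by linarith
  have hδ0 : 0 ≤ δ' := hδ.trans hδ'.le
  have hD0 : 0 < D := by linarith
  set ρ := 2 * η * δ' + δ' ^ 2 with hρ
  have hρ0 : 0 ≤ ρ := by positivity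
  have hρle : ρ ≤ σ ^ 2 * (2 / 3 * (1 - α)) * √D :=
    two_mul_add_sq_le_of_le_dimensionFactor hσ hD0 hβ hη hδ0 hlt'.le
  have hD1 : 0 < D - 1 := by linarith
  -- The shift in direction `i ≠ i₀` has length `√c * r i ^ 2`, and `c` makes the total squared
  -- length `ρ`. Weights `w i ^ 2` proportional to `r i ^ 2` are the equality case of
  -- Cauchy-Schwarz, giving the largest squared shift for a given `∑ w i ^ 4`. Omitting `i₀` turns
  -- `D` into `D - 1`.
  set c := ρ / (opNorm S ^ 2 * (D - 1)) with hc
  have hc0 : 0 ≤ c := by positivity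
  set w : Fin d → ℝ := fun i => if i = i₀ then 0 else √c * r i with hw
  have hsum : ∑ i, (if i = i₀ then 0 else (r i ^ 2) ^ 2) = opNorm S ^ 2 * (D - 1) := by
    have h1 := Finset.add_sum_erase Finset.univ (fun i => (r i ^ 2) ^ 2) (Finset.mem_univ i₀)
    rw [← htr, hDdef] at h1
    have h2 : ∑ i, (if i = i₀ then 0 else (r i ^ 2) ^ 2)
        = ∑ i ∈ Finset.univ.erase i₀, (r i ^ 2) ^ 2 := by
      rw [← Finset.add_sum_erase Finset.univ _ (Finset.mem_univ i₀)]
      simp only [if_true, zero_add]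
      exact Finset.sum_congr rfl fun i hi => if_neg (Finset.ne_of_mem_erase hi)
    rw [h2]
    simp only [hi₀] at h1
    linarith
  have hc2 : √c ^ 2 = c := Real.sq_sqrt hc0
  have hsumw : ∑ i, w i ^ 4 = c * ρ := by
    have : ∀ i, w i ^ 4 = c ^ 2 * (if i = i₀ then 0 else (r i ^ 2) ^ 2) := by
      intro i
      simp only [hw]
      split_ifs
      · simp
      · rw [show c ^ 2 * (r i ^ 2) ^ 2 = (√c ^ 2) ^ 2 * (r i ^ 2) ^ 2 by rw [hc2]]
        ring
    simp_rw [this]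
    rw [← Finset.mul_sum, hsum, hc]
    field_simp
  have key := one_sub_le_of_alternatives hr (ι := Fin d → Bool) (κ := (1 - α) / 3) hα.le hη hδ
    (by positivity) hT herr (Pi.single i₀ η) ?_
    (fun k i => (bif k i then 1 else -1) * w i) ?_ ?_
  · linarith
  · rw [Finset.sum_eq_single i₀] <;> simp +contextual
  · intro k
    have hi : ∀ i, ((Pi.single i₀ η : Fin d → ℝ) i + r i * ((bif k i then 1 else -1) * w i)) ^ 2
        = (if i = i₀ then η ^ 2 else 0) + c * (if i = i₀ then 0 else (r i ^ 2) ^ 2) := by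
      intro i
      by_cases hii : i = i₀
      · subst hii
        simp [hw]
      · simp only [hw, if_neg hii, Pi.single_eq_of_ne hii]
        rw [show c * (r i ^ 2) ^ 2 = √c ^ 2 * (r i ^ 2) ^ 2 by rw [hc2]]
        cases k i <;> simp only [cond_true, cond_false] <;> ring
    simp_rw [hi]
    rw [Finset.sum_add_distrib, ← Finset.mul_sum, hsum, Finset.sum_ite_eq' Finset.univ i₀,
      if_pos (Finset.mem_univ _)]
    have : c * (opNorm S ^ 2 * (D - 1)) = ρ := by rw [hc]; field_simp
    rw [this, hρ]
    nlinarith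
  · refine (sum_sum_exp_sign_mul_le w n).trans ?_
    refine mul_le_mul_of_nonneg_left ?_ (by positivity)
    set x := (n : ℝ) ^ 2 * (∑ i, w i ^ 4) / 2 with hx
    have hx0 : 0 ≤ x := by rw [hx, hsumw]; positivity
    have hxe : x * (2 * (D - 1) * (σ ^ 2) ^ 2) = ρ ^ 2 := by
      rw [hx, hsumw, hc, hσ2]
      field_simp
    have hρ2 : ρ ^ 2 ≤ (σ ^ 2) ^ 2 * (4 / 9 * (1 - α) ^ 2) * D := by
      refine (pow_le_pow_left₀ hρ0 hρle 2).trans_eq ?_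
      rw [mul_pow, Real.sq_sqrt hD0.le]
      ring
    have hx1 : x ≤ (1 - α) ^ 2 / 3 := by
      have hp : 0 < 2 * (D - 1) * (σ ^ 2) ^ 2 := by positivity
      refine le_of_mul_le_mul_right ?_ hp
      rw [hxe]
      refine hρ2.trans ?_
      -- The bound needed is `(4/9) D ≤ (2/3) (D - 1)`, which is exactly `D ≥ 3`.
      have : 0 ≤ (σ ^ 2) ^ 2 * (1 - α) ^ 2 * (D - 3) := by
        have : 0 ≤ D - 3 := by linarith
        positivity
      linarith
    exact Real.exp_le_one_add_four_mul_div_three_sq hx0 hβ.le (by linarith) hx1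

end LowerBound

/-! ### Exponential moments of Gaussian quadratic forms -/

theorem integral_exp_quadratic_gaussianReal (b : ℝ) {c : ℝ} (hc : c < 1 / 2) :
    ∫ x, Real.exp (b * x + c * x ^ 2) ∂(gaussianReal 0 1)
      = (√(1 - 2 * c))⁻¹ * Real.exp (b ^ 2 / (2 * (1 - 2 * c))) := by
  have hβ : 0 < 1 / 2 - c := by linarith
  have hβ2 : 0 < 1 - 2 * c := by linarith
  rw [integral_gaussianReal_eq_integral_smul one_ne_zero]
  have h1 : ∀ x : ℝ, gaussianPDFReal 0 1 x • Real.exp (b * x + c * x ^ 2)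
      = (√(2 * Real.pi))⁻¹ * Real.exp (b ^ 2 / (2 * (1 - 2 * c))) *
        Real.exp (-(1 / 2 - c) * (x - b / (1 - 2 * c)) ^ 2) := by
    intro x
    rw [gaussianPDFReal, smul_eq_mul, mul_assoc (_⁻¹), mul_assoc (_⁻¹), ← Real.exp_add,
      ← Real.exp_add]
    simp only [NNReal.coe_one, mul_one]
    congr 2
    field_simp
    ring
  simp_rw [h1]
  rw [integral_const_mul,
    integral_sub_right_eq_self (fun x => Real.exp (-(1 / 2 - c) * x ^ 2)) (b / (1 - 2 * c)),
    integral_gaussian]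
  have h2 : Real.pi / (1 / 2 - c) = 2 * Real.pi * (1 - 2 * c)⁻¹ := by
    field_simp
  have h3 : 0 < √(2 * Real.pi) := by positivity
  rw [h2, Real.sqrt_mul (by positivity : 0 ≤ 2 * Real.pi), Real.sqrt_inv]
  field_simp

theorem integrable_exp_quadratic_gaussianReal (b : ℝ) {c : ℝ} (hc : c < 1 / 2) :
    Integrable (fun x => Real.exp (b * x + c * x ^ 2)) (gaussianReal 0 1) := by
  -- A non-integrable function has integral `0` by convention, whereas the closed form is positive.
  by_contra h
  have h1 := integral_exp_quadratic_gaussianReal b hc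
  rw [integral_undef h] at h1
  have hβ2 : 0 < 1 - 2 * c := by linarith
  have : 0 < (√(1 - 2 * c))⁻¹ * Real.exp (b ^ 2 / (2 * (1 - 2 * c))) := by positivity
  linarith

/-- With `y = 2c` this gives `(1 - 2c)^(-1/2) ≤ exp (c + 2c²)`, for either sign of `c`. -/
theorem Real.exp_neg_add_sq_le {y : ℝ} (h1 : |y| ≤ 1 / 2) :
    Real.exp (-(y + y ^ 2)) ≤ 1 - y := by
  obtain ⟨hl, hu⟩ := abs_le.mp h1
  rw [Real.exp_neg, inv_le_iff_one_le_mul₀ (Real.exp_pos _)]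
  rcases le_total 0 y with h0 | h0
  · have hq := Real.quadratic_le_exp_of_nonneg (x := y + y ^ 2) (by positivity)
    have h2 : 0 ≤ 1 - y := by linarith
    refine le_trans ?_ (mul_le_mul_of_nonneg_left hq h2)
    have h3 : (1 - y) * (1 + (y + y ^ 2) + (y + y ^ 2) ^ 2 / 2) - 1
        = y ^ 2 * ((1 - y - y ^ 2 - y ^ 3) / 2) := by ring
    have h4 : 0 ≤ 1 - y - y ^ 2 - y ^ 3 := by nlinarith [mul_nonneg h0 h0]
    have h5 : 0 ≤ y ^ 2 * ((1 - y - y ^ 2 - y ^ 3) / 2) := by positivity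
    linarith
  · have hq := Real.add_one_le_exp (y + y ^ 2)
    have h2 : 0 ≤ 1 - y := by linarith
    refine le_trans ?_ (mul_le_mul_of_nonneg_left hq h2)
    nlinarith [mul_nonneg (neg_nonneg.mpr h0) (sq_nonneg y)]

theorem integral_exp_quadratic_gaussianReal_le (b : ℝ) {c : ℝ} (hc : |c| ≤ 1 / 4) :
    ∫ x, Real.exp (b * x + c * x ^ 2) ∂(gaussianReal 0 1)
      ≤ Real.exp (c + 2 * c ^ 2 + b ^ 2) := by
  obtain ⟨hl, hu⟩ := abs_le.mp hc
  have hβ2 : 1 / 2 ≤ 1 - 2 * c := by linarith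
  rw [integral_exp_quadratic_gaussianReal b (by linarith), Real.exp_add]
  have h1 := Real.exp_neg_add_sq_le (y := 2 * c) (by rw [abs_mul, abs_two]; linarith)
  gcongr
  · rw [inv_le_comm₀ (by positivity) (Real.exp_pos _), ← Real.exp_neg]
    refine Real.le_sqrt_of_sq_le ?_
    rw [← Real.exp_nat_mul]
    refine le_trans (le_of_eq ?_) h1
    congr 1
    push_cast
    ring
  · rw [div_le_iff₀ (by linarith)]
    nlinarith [sq_nonneg b]

/-- The squared norm splits into independent quadratics over the eigenbasis. The witness `t` is the
trace of `S`; it stays anonymous because the threshold of the test absorbs it. Both signs of `θ` are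
needed, one for each type of error. -/
theorem integral_exp_mul_norm_sq_multivariateGaussian {d : ℕ} {S : Matrix (Fin d) (Fin d) ℝ}
    (hS : S.PosSemidef) :
    ∃ t : ℝ, ∀ (μ : EuclideanSpace ℝ (Fin d)) (θ : ℝ), |θ| * opNorm S ≤ 1 / 4 →
      Integrable (fun x => Real.exp (θ * ‖x‖ ^ 2)) (multivariateGaussian μ S) ∧
      ∫ x, Real.exp (θ * ‖x‖ ^ 2) ∂(multivariateGaussian μ S)
        ≤ Real.exp (θ * (‖μ‖ ^ 2 + t) + 2 * θ ^ 2 * (S ^ 2).trace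
            + 4 * θ ^ 2 * opNorm S * ‖μ‖ ^ 2) := by
  obtain ⟨b, r, hr0, hr, hrS⟩ := hS.exists_orthonormalBasis_sqrt
  refine ⟨∑ i, r i ^ 2, fun μ θ hθ => ?_⟩
  have htr := trace_sq_eq_sum_of_eigen hrS
  have hle := le_opNorm_of_eigen hrS
  set m : Fin d → ℝ := fun i => inner ℝ (b i) μ with hm
  have hμ : μ = ∑ i, m i • b i := (b.sum_repr' μ).symm
  have hμn : ‖μ‖ ^ 2 = ∑ i, m i ^ 2 := (b.sum_sq_inner_right μ).symm
  have hlaw := map_pi_gaussianReal_eq_multivariateGaussian hr μ (fun _ => 0)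
  simp only [mul_zero, zero_smul, Finset.sum_const_zero, add_zero] at hlaw
  have hnorm : ∀ x : Fin d → ℝ, Real.exp (θ * ‖μ + ∑ i, (r i * x i) • b i‖ ^ 2)
      = Real.exp (θ * ‖μ‖ ^ 2) *
        ∏ i, Real.exp ((2 * θ * r i * m i) * x i + (θ * r i ^ 2) * x i ^ 2) := by
    intro x
    rw [← Real.exp_sum, ← Real.exp_add, hμn]
    nth_rw 1 [hμ]
    rw [← Finset.sum_add_distrib]
    simp_rw [← add_smul]
    rw [b.norm_sq_sum_smul, Finset.mul_sum, Finset.mul_sum, ← Finset.sum_add_distrib]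
    congr 1
    exact Finset.sum_congr rfl fun i _ => by ring
  have hc : ∀ i, |θ * r i ^ 2| ≤ 1 / 4 := fun i => by
    rw [abs_mul, abs_of_nonneg (sq_nonneg (r i))]
    exact (mul_le_mul_of_nonneg_left (hle i) (abs_nonneg θ)).trans hθ
  have hc2 : ∀ i, θ * r i ^ 2 < 1 / 2 := fun i => by
    linarith [le_abs_self (θ * r i ^ 2), hc i]
  have hmeas : AEMeasurable (fun x : Fin d → ℝ => μ + ∑ i, (r i * x i) • b i)
    (Measure.pi fun _ => gaussianReal 0 1) := Measurable.aemeasurable (by fun_prop)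
  have hF : Measurable (fun x : EuclideanSpace ℝ (Fin d) => Real.exp (θ * ‖x‖ ^ 2)) := by
    fun_prop
  rw [← hlaw, integrable_map_measure hF.aestronglyMeasurable hmeas,
    integral_map hmeas hF.aestronglyMeasurable]
  simp_rw [Function.comp_def, hnorm]
  refine ⟨(Integrable.fintype_prod (f := fun i (y : ℝ) =>
    Real.exp ((2 * θ * r i * m i) * y + (θ * r i ^ 2) * y ^ 2))
    fun i => integrable_exp_quadratic_gaussianReal _ (hc2 i)).const_mul _, ?_⟩
  rw [integral_const_mul, integral_fintype_prod_eq_prod (fun i (y : ℝ) =>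
    Real.exp ((2 * θ * r i * m i) * y + (θ * r i ^ 2) * y ^ 2))]
  calc _ ≤ Real.exp (θ * ‖μ‖ ^ 2) * ∏ i, Real.exp (θ * r i ^ 2 + 2 * (θ * r i ^ 2) ^ 2
            + (2 * θ * r i * m i) ^ 2) := by
        refine mul_le_mul_of_nonneg_left (Finset.prod_le_prod (fun i _ => ?_) fun i _ => ?_)
          (Real.exp_pos _).le
        · exact integral_nonneg fun _ => (Real.exp_pos _).le
        · exact integral_exp_quadratic_gaussianReal_le _ (hc i)
    _ ≤ _ := by
        rw [← Real.exp_sum, ← Real.exp_add, htr, hμn, Real.exp_le_exp, mul_add]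
        simp only [Finset.mul_sum, ← Finset.sum_add_distrib]
        refine Finset.sum_le_sum fun i _ => ?_
        have : r i ^ 2 * (4 * θ ^ 2 * m i ^ 2) ≤ opNorm S * (4 * θ ^ 2 * m i ^ 2) :=
          mul_le_mul_of_nonneg_right (hle i) (by positivity)
        linarith

/-! ### The test based on the norm of the empirical mean -/

section UpperBound

variable {d n : ℕ} {S : Matrix (Fin d) (Fin d) ℝ}

theorem opNorm_smul {a : ℝ} (ha : 0 ≤ a) : opNorm (a • S) = a * opNorm S := by
  rw [opNorm, map_smul, norm_smul, Real.norm_of_nonneg ha, opNorm]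

theorem one_le_effectiveDim (hS : S.PosSemidef) (hS0 : S ≠ 0) : 1 ≤ effectiveDim S := by
  have := nonempty_of_matrix_ne_zero hS0
  obtain ⟨b, r, hr0, hr, hrS⟩ := hS.exists_orthonormalBasis_sqrt
  obtain ⟨i₀, hi₀⟩ := exists_eq_opNorm_of_eigen hrS (fun i => sq_nonneg _)
  rw [effectiveDim, one_le_div (pow_pos (opNorm_pos hS0) 2), trace_sq_eq_sum_of_eigen hrS, ← hi₀]
  exact Finset.single_le_sum (f := fun i => (r i ^ 2) ^ 2) (fun i _ => by positivity)
    (Finset.mem_univ i₀)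

theorem integral_exp_mul_norm_sq_mean (hn : 1 ≤ n) (hS : S.PosSemidef) (hS0 : S ≠ 0) :
    ∃ t : ℝ, ∀ (μ : EuclideanSpace ℝ (Fin d)) (θ : ℝ), |θ| * noiseLevel n S ^ 2 ≤ 1 / 4 →
      Integrable (fun x => Real.exp (θ * ‖(n : ℝ)⁻¹ • ∑ j, x j‖ ^ 2)) (gaussianSample n μ S) ∧
      ∫ x, Real.exp (θ * ‖(n : ℝ)⁻¹ • ∑ j, x j‖ ^ 2) ∂(gaussianSample n μ S)
        ≤ Real.exp (θ * (‖μ‖ ^ 2 + t) + 2 * θ ^ 2 * (noiseLevel n S ^ 4 * effectiveDim S)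
            + 4 * θ ^ 2 * noiseLevel n S ^ 2 * ‖μ‖ ^ 2) := by
  have hn0 : (0 : ℝ) < n := by exact_mod_cast hn
  have hop := opNorm_pos hS0
  have hσ2 := noiseLevel_sq n S
  obtain ⟨t, ht⟩ := integral_exp_mul_norm_sq_multivariateGaussian
    (hS.smul (inv_nonneg.mpr hn0.le))
  have h1 : opNorm ((n : ℝ)⁻¹ • S) = noiseLevel n S ^ 2 := by
    rw [opNorm_smul (by positivity), hσ2]; field_simp
  have h2 : (((n : ℝ)⁻¹ • S) ^ 2).trace = noiseLevel n S ^ 4 * effectiveDim S := by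
    rw [smul_pow, Matrix.trace_smul, smul_eq_mul, effectiveDim,
      show noiseLevel n S ^ 4 = (noiseLevel n S ^ 2) ^ 2 by ring, hσ2]
    field_simp
  refine ⟨t, fun μ θ hθ => ?_⟩
  have h3 := ht μ θ (by rwa [h1])
  have hmeas : AEMeasurable (fun x : Fin n → EuclideanSpace ℝ (Fin d) => (n : ℝ)⁻¹ • ∑ j, x j)
    (gaussianSample n μ S) := by fun_prop
  have hF : Measurable (fun x : EuclideanSpace ℝ (Fin d) => Real.exp (θ * ‖x‖ ^ 2)) := by
    fun_prop
  rw [← map_mean_gaussianSample hn hS, integrable_map_measure hF.aestronglyMeasurable hmeas,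
    integral_map hmeas hF.aestronglyMeasurable, h1, h2] at h3
  exact h3

instance isProbabilityMeasure_gaussianSample (n : ℕ) (μ : EuclideanSpace ℝ (Fin d))
    (S : Matrix (Fin d) (Fin d) ℝ) : IsProbabilityMeasure (gaussianSample n μ S) := by
  unfold gaussianSample; infer_instance

/-- The test which rejects for a large norm of the empirical mean. -/
theorem exists_test_of_chernoff (hn : 1 ≤ n) (hS : S.PosSemidef) (hS0 : S ≠ 0) {α η δ θ u : ℝ}
    (hα : 0 ≤ α) (hη : 0 ≤ η) (hδ : 0 ≤ δ) (hθ : 0 < θ) (hθσ : 8 * θ * noiseLevel n S ^ 2 ≤ 1)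
    (hu : Real.exp (-u) ≤ α / 2)
    (h : 4 * θ * (noiseLevel n S ^ 4 * effectiveDim S) + 8 * θ * noiseLevel n S ^ 2 * η ^ 2
      + 2 * u / θ ≤ η * δ + δ ^ 2 / 2) :
    ∃ T : (Fin n → EuclideanSpace ℝ (Fin d)) → Bool, Measurable T ∧
      typeIError n S η T + typeIIError n S η δ T ≤ ENNReal.ofReal α := by
  obtain ⟨t, ht⟩ := integral_exp_mul_norm_sq_mean hn hS hS0
  set σ := noiseLevel n S
  set V := σ ^ 4 * effectiveDim S
  set Y : (Fin n → EuclideanSpace ℝ (Fin d)) → ℝ := fun x => ‖(n : ℝ)⁻¹ • ∑ j, x j‖ ^ 2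
  have hY : Measurable Y := by fun_prop
  -- The threshold for which Chernoff's bound at `‖μ‖ = η` is exactly `exp (-u)`.
  set τ := η ^ 2 + t + 2 * θ * V + 4 * θ * σ ^ 2 * η ^ 2 + u / θ with hτ
  have hτθ : θ * τ = θ * (η ^ 2 + t) + 2 * θ ^ 2 * V + 4 * θ ^ 2 * σ ^ 2 * η ^ 2 + u := by
    rw [hτ]; field_simp
  have hθθ : |θ| * σ ^ 2 ≤ 1 / 4 := by rw [abs_of_pos hθ]; nlinarith [sq_nonneg σ]
  have hθθ' : |-θ| * σ ^ 2 ≤ 1 / 4 := by rwa [abs_neg]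
  refine ⟨fun x => decide (τ ≤ Y x), ?_, ?_⟩
  · refine measurable_to_bool ?_
    have : (fun x => decide (τ ≤ Y x)) ⁻¹' {true} = {x | τ ≤ Y x} := by ext; simp
    rw [this]
    exact measurableSet_le measurable_const hY
  · have hI : typeIError n S η (fun x => decide (τ ≤ Y x)) ≤ ENNReal.ofReal (α / 2) := by
      refine iSup₂_le fun μ hμ => ?_
      simp only [decide_eq_true_eq]
      rw [← ofReal_measureReal]
      refine ENNReal.ofReal_le_ofReal ?_
      obtain ⟨hi, hb⟩ := ht μ θ hθθ
      refine (measure_ge_le_exp_mul_mgf τ hθ.le hi).trans (le_trans ?_ hu)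
      refine (mul_le_mul_of_nonneg_left hb (Real.exp_pos _).le).trans ?_
      rw [← Real.exp_add, Real.exp_le_exp]
      have h1 : ‖μ‖ ^ 2 ≤ η ^ 2 := pow_le_pow_left₀ (norm_nonneg _) hμ 2
      have h2 : 0 ≤ (θ + 4 * θ ^ 2 * σ ^ 2) * (η ^ 2 - ‖μ‖ ^ 2) :=
        mul_nonneg (by positivity) (by linarith)
      linarith
    have hII : typeIIError n S η δ (fun x => decide (τ ≤ Y x)) ≤ ENNReal.ofReal (α / 2) := by
      refine iSup₂_le fun μ hμ => ?_
      simp only [decide_eq_false_iff_not]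
      rw [← ofReal_measureReal]
      refine ENNReal.ofReal_le_ofReal ?_
      obtain ⟨hi, hb⟩ := ht μ (-θ) hθθ'
      refine (measureReal_mono (s₂ := {x | Y x ≤ τ}) fun x hx => (not_le.mp hx).le).trans ?_
      refine (measure_le_le_exp_mul_mgf τ (neg_nonpos.mpr hθ.le) hi).trans (le_trans ?_ hu)
      refine (mul_le_mul_of_nonneg_left hb (Real.exp_pos _).le).trans ?_
      rw [← Real.exp_add, Real.exp_le_exp]
      have h1 : (η + δ) ^ 2 ≤ ‖μ‖ ^ 2 := pow_le_pow_left₀ (by positivity) hμ.le 2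
      -- The exponent decreases in `‖μ‖²`, so `‖μ‖ = η + δ` is the worst case; then `1 - 4θσ² ≥ 1/2`
      -- (`h3`) leaves half of `2ηδ + δ²`, the right side of `h`.
      have h2 : 0 ≤ θ * (1 - 4 * θ * σ ^ 2) * (‖μ‖ ^ 2 - (η + δ) ^ 2) :=
        mul_nonneg (mul_nonneg hθ.le (by nlinarith [sq_nonneg σ])) (by linarith)
      have h3 : 0 ≤ θ * (1 - 8 * θ * σ ^ 2) * (2 * η * δ + δ ^ 2) :=
        mul_nonneg (mul_nonneg hθ.le (by linarith)) (by positivity)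
      have h4 : θ * (4 * θ * V + 8 * θ * σ ^ 2 * η ^ 2 + 2 * u / θ)
          ≤ θ * (η * δ + δ ^ 2 / 2) := mul_le_mul_of_nonneg_left h hθ.le
      have h5 : θ * (2 * u / θ) = 2 * u := by field_simp
      rw [mul_add, h5] at h4
      linarith
    refine (add_le_add hI hII).trans_eq ?_
    rw [← ENNReal.ofReal_add (by positivity) (by positivity), add_halves]

theorem separationDistance_le (hn : 1 ≤ n) (hS : S.PosSemidef) (hS0 : S ≠ 0) {α η : ℝ}
    (hα : 0 < α) (hα1 : α < 1) (hη : 0 ≤ η) :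
    separationDistance n S α η ≤ ENNReal.ofReal
      (34 * (noiseLevel n S * √(-Real.log α + Real.log 60) *
        max 1 (dimensionFactor (effectiveDim S) (-Real.log α + Real.log 60)
          (noiseLevel n S) η))) := by
  set u := -Real.log α + Real.log 60 with hudef
  -- Only `1 ≤ u` and `exp (-u) ≤ α / 2` are used of `u`; the constant `60` leaves room for both.
  have hu1 : 1 ≤ u := by
    have h1 : Real.log α < 0 := Real.log_neg hα hα1
    have h2 : 1 ≤ Real.log 60 := by
      rw [Real.le_log_iff_exp_le (by norm_num)]
      linarith [Real.exp_one_lt_d9]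
    linarith
  have hexp : Real.exp (-u) ≤ α / 2 := by
    rw [hudef, neg_add, neg_neg, Real.exp_add, Real.exp_log hα, Real.exp_neg,
      Real.exp_log (by norm_num)]
    linarith
  have hσ := noiseLevel_pos hn hS0
  have hD := one_le_effectiveDim hS hS0
  set F := max 1 (dimensionFactor (effectiveDim S) u (noiseLevel n S) η) with hF
  have hF1 : 1 ≤ F := le_max_left _ _
  set δ : ℝ := 34 * (noiseLevel n S * √u * F) with hδ
  have hδ0 : 0 ≤ δ := by positivity
  suffices h : ∃ T : (Fin n → EuclideanSpace ℝ (Fin d)) → Bool, Measurable T ∧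
      typeIError n S η T + typeIIError n S η δ T ≤ ENNReal.ofReal α by
    rw [ENNReal.ofReal]
    exact iInf₂_le δ.toNNReal (by rwa [Real.coe_toNNReal _ hδ0])
  set σ := noiseLevel n S
  set D := effectiveDim S
  set h := η / σ with hh
  have hη' : η = h * σ := by rw [hh]; field_simp
  have hh0 : 0 ≤ h := by positivity
  -- The exponent `√u / (8σ²q)` balances, up to constants, the variance terms `θσ⁴(D + h²)` against
  -- `u / θ`; the summand `u` in `q` enforces `8θσ² ≤ 1`.
  set q := √(D + u + h ^ 2) with hq
  have hqpos : 0 < q := by positivity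
  have hq2 : q ^ 2 = D + u + h ^ 2 := Real.sq_sqrt (by positivity)
  have hupos : 0 < √u := by positivity
  have hu2 : √u ^ 2 = u := Real.sq_sqrt (by linarith)
  have huq : √u ≤ q := Real.sqrt_le_sqrt (by nlinarith)
  have hqle : q ≤ √D + √u + h := by
    rw [hq, Real.sqrt_le_left (by positivity)]
    have h1 : √D ^ 2 = D := Real.sq_sqrt (by linarith)
    have h2 : 0 ≤ √D := Real.sqrt_nonneg _
    nlinarith [mul_nonneg h2 hupos.le, mul_nonneg h2 hh0, mul_nonneg hh0 hupos.le]
  refine exists_test_of_chernoff hn hS hS0 hα.le hη hδ0 (θ := √u / (8 * σ ^ 2 * q)) (u := u)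
    (by positivity) ?_ hexp ?_
  · change 8 * (√u / (8 * σ ^ 2 * q)) * σ ^ 2 ≤ 1
    have : 8 * (√u / (8 * σ ^ 2 * q)) * σ ^ 2 = √u / q := by field_simp
    rw [this, div_le_one hqpos]
    exact huq
  · change 4 * (√u / (8 * σ ^ 2 * q)) * (σ ^ 4 * D) + 8 * (√u / (8 * σ ^ 2 * q)) * σ ^ 2 * η ^ 2
      + 2 * u / (√u / (8 * σ ^ 2 * q)) ≤ η * δ + δ ^ 2 / 2
    have e1 : 4 * (√u / (8 * σ ^ 2 * q)) * (σ ^ 4 * D)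
        + 8 * (√u / (8 * σ ^ 2 * q)) * σ ^ 2 * η ^ 2 + 2 * u / (√u / (8 * σ ^ 2 * q))
        = σ ^ 2 * (√u * ((D / 2 + h ^ 2) / q + 16 * q)) := by
      rw [hη']
      have : 2 * u / (√u / (8 * σ ^ 2 * q)) = 2 * √u * (8 * σ ^ 2 * q) := by
        rw [← hu2, Real.sqrt_sq hupos.le]; field_simp
      rw [this]
      field_simp
      ring
    have e2 : (D / 2 + h ^ 2) / q ≤ q := by
      rw [div_le_iff₀ hqpos, ← sq, hq2]; linarith
    have e3 : √u * ((D / 2 + h ^ 2) / q + 16 * q) ≤ 17 * (√u * √D + u + √u * h) := by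
      calc _ ≤ √u * (17 * (√D + √u + h)) := by gcongr; linarith
        _ = 17 * (√u * √D + √u ^ 2 + √u * h) := by ring
        _ = _ := by rw [hu2]
    have e4 : η * δ + δ ^ 2 / 2 = σ ^ 2 * (34 * (h * √u * F) + 578 * (u * F ^ 2)) := by
      rw [hη', hδ, ← hu2, Real.sqrt_sq hupos.le]; ring
    rw [e1, e4]
    refine mul_le_mul_of_nonneg_left (e3.trans ?_) (by positivity)
    have f1 : h * √u ≤ h * √u * F := le_mul_of_one_le_right (by positivity) hF1
    have f2 : u ≤ u * F ^ 2 := le_mul_of_one_le_right (by linarith) (one_le_pow₀ hF1)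
    -- It remains to bound `17 (√u √D + u + √u h)`. By `f1`, `f2` and `f3` the bracket is at most
    -- twice `h√uF + uF²`, hence the constant `34 = 2 · 17`. For `f3`, the entry attaining the
    -- minimum gives either `√D ≤ F²` or `√u √D ≤ hF`.
    have hsu : √u ≤ u := by
      rw [Real.sqrt_le_left (by linarith)]; nlinarith
    have f3 : √u * √D ≤ h * √u * F + u * F ^ 2 := by
      have hFd : dimensionFactor D u σ η ≤ F := le_max_right _ _
      have hD4 : (D ^ (1 / 4 : ℝ)) ^ 2 = √D := by
        rw [← Real.rpow_natCast, ← Real.rpow_mul (by linarith), Real.sqrt_eq_rpow]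
        norm_num
      have hcase1 : D ^ (1 / 4 : ℝ) ≤ F → √u * √D ≤ h * √u * F + u * F ^ 2 := by
        intro hc
        have : √D ≤ F ^ 2 := by
          rw [← hD4]
          exact pow_le_pow_left₀ (by positivity) hc 2
        have : √u * √D ≤ u * F ^ 2 := by gcongr
        have : 0 ≤ h * √u * F := by positivity
        linarith
      unfold dimensionFactor at hFd
      split_ifs at hFd with h0
      · exact hcase1 hFd
      · rcases min_le_iff.mp hFd with hc | hc
        · exact hcase1 hc
        · have hηpos : 0 < η := lt_of_le_of_ne hη (Ne.symm h0)
          have hhpos : 0 < h := by positivity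
          have : √u * √D ≤ h * F := by
            have e : σ / η = h⁻¹ := by rw [hh, inv_div]
            rw [e, ← div_eq_mul_inv, div_le_iff₀ hhpos, Real.sqrt_mul (by linarith)] at hc
            linarith
          have h3 : h * F ≤ h * √u * F := by
            have : 1 ≤ √u := Real.one_le_sqrt.mpr hu1
            rw [mul_right_comm]
            exact le_mul_of_one_le_right (by positivity) this
          have : 0 ≤ u * F ^ 2 := by positivity
          linarith
    linarith

end UpperBound

theorem theorem2 :
    ∃ C : ℝ, 0 < C ∧
      ∀ (d n : ℕ) (S : Matrix (Fin d) (Fin d) ℝ) (α η : ℝ),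
        1 ≤ n → S.PosSemidef → S ≠ 0 → 0 < α → α < 1 → 0 ≤ η →
        separationDistance n S α η ≤
            ENNReal.ofReal
              (C * (noiseLevel n S * √(-Real.log α + Real.log 60) *
                max 1 (dimensionFactor (effectiveDim S) (-Real.log α + Real.log 60)
                  (noiseLevel n S) η))) ∧
        (3 ≤ effectiveDim S →
          ENNReal.ofReal
              (noiseLevel n S * √((1 - α) / 12) *
                max (min 1 (6 * √(1 - α)))
                  (dimensionFactor (effectiveDim S) (1 - α) (noiseLevel n S) η)) ≤
            separationDistance n S α η) := by
  refine ⟨34, by norm_num, fun d n S α η hn hS hS0 hα hα1 hη =>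
    ⟨separationDistance_le hn hS hS0 hα hα1 hη, fun hD => ?_⟩⟩
  refine le_iInf₂ fun δ ⟨T, hT, herr⟩ => ?_
  rw [← ENNReal.ofReal_coe_nnreal]
  refine ENNReal.ofReal_le_ofReal ?_
  rw [mul_max_of_nonneg _ _ (mul_nonneg (noiseLevel_pos hn hS0).le (Real.sqrt_nonneg _))]
  exact max_le (le_of_two_point hn hS hS0 hα hα1 hη δ.coe_nonneg hT herr)
    (le_of_rademacher_mixture hn hS hS0 hα hα1 hη δ.coe_nonneg hD hT herr)
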